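/- Let $A$ be a set with at least two elements, and let $\mathcal G=(A,E)$ be a graph on $A$, that is, $E\subseteq\{\{a,b\}: a,b\in A\}$ with $\{a\}\in E$ for every $a\in A$. Call $\mathcal G$ connected if any two vertices $v,u$ are joined by a finite chain $v=v_1,\dots,v_n=u$ in $A$ with $\{v_k,v_{k+1}\}\in E$ for $1\le k<n$. Let $N(A)=A^{\mathbb N}$, $\mathbb N=\{1,2,\dots\}$, with the metric $d(x,x)=0$ and $d(x,y)=1/\min\{n: x_n\ne y_n\}$ for $x\neq y$. Let $\sim$ be the equivalence relation on $N(A)$ for which $x\sim y$ if and only if $x=y$, or $x=s\,a\,bbb\dots$ and $y=s\,b\,aaa\dots$ for some finite (possibly empty) word $s$ over $A$ and some $a,b\in A$ with $\{a,b\}\in E$. Let $J_A^{\mathcal G}=N(A)/{\sim}$ with the quotient topology (the graph Lipscomb space). Fix $z\in A$ and put $A'=A\setminus\{z\}$. For $a,a',b\in A$ let $c_{aa'b}=0$ if $a'\ne b$, $c_{aa'b}=\frac12$ if $a'=b$ and $\{a,a'\}\in E$, and $c_{aa'b}=\frac13$ if $a'=b$ and $\{a,a'\}\notin E$. Define $p_{\mathcal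 G}:N(A)\to\ell^2(A')$ by $p_{\mathcal G}(x)=(\alpha_b(x))_{b\in A'}$, where $\alpha_b(x)=\sum_{i=1}^\infty\prod_{j=1}^i c_{x_jx_ib}$, and let $\omega_{\mathcal G}^A=p_{\mathcal G}(N(A))$ with the topology induced by the norm of $\ell^2(A')$. Then the following statements are equivalent: (i) the space $J_A^{\mathcal G}$ is connected; (ii) the space $\omega_{\mathcal G}^A$ is connected; (iii) the graph $\mathcal G$ is connected. -/

import Mathlib

/-- A graph on the vertex set `A`: undirected, without multiple edges, with a loop at every vertex.
An edge `{v, u}` (possibly with `v = u`) is an unordered pair `s(v, u)`. -/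
structure LoopGraph (A : Type*) where
  edges : Set (Sym2 A)
  loop_mem : ∀ v : A, s(v, v) ∈ edges

namespace LoopGraph

/-- A graph is connected if any two vertices `v`, `u` are joined by a finite chain
`v = w 0, w 1, …, w n = u` of vertices in which consecutive ones are adjacent. -/
def Connected {A : Type*} (G : LoopGraph A) : Prop :=
  ∀ v u : A, ∃ (n : ℕ) (w : ℕ → A), w 0 = v ∧ w n = u ∧ ∀ k < n, s(w k, w (k + 1)) ∈ G.edges

end LoopGraph

/-- The set of infinite words `x 0, x 1, x 2, …` over the alphabet `A` (letters are numbered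
from `0`). It carries the metric defined below, not a product structure. -/
def InfWord (A : Type*) : Type _ := ℕ → A

namespace InfWord

/-- The distance `1 / m`, where `m` is the position of the first difference counted from `1`. -/
noncomputable def baireDist {A : Type*} (x y : InfWord A) : ℝ :=
  open Classical in
  if h : ∃ n : ℕ, x n ≠ y n then 1 / ((Nat.find h : ℝ) + 1) else 0

theorem baireDist_self {A : Type*} (x : InfWord A) : baireDist x x = 0 := by
  simp [baireDist]

theorem baireDist_comm {A : Type*} (x y : InfWord A) : baireDist x y = baireDist y x := by
  classical
  unfold baireDist
  by_cases h : ∃ n : ℕ, x n ≠ y n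
  · have h' : ∃ n : ℕ, y n ≠ x n := h.imp fun _ => Ne.symm
    rw [dif_pos h, dif_pos h', Nat.find_congr' (hp := h) (hq := h') ne_comm]
  · have h' : ¬ ∃ n : ℕ, y n ≠ x n := fun h' => h (h'.imp fun _ => Ne.symm)
    rw [dif_neg h, dif_neg h']

theorem baireDist_nonneg {A : Type*} (x y : InfWord A) : 0 ≤ baireDist x y := by
  unfold baireDist
  split_ifs
  · positivity
  · exact le_rfl

theorem baireDist_le_iff {A : Type*} (x y : InfWord A) (n : ℕ) :
    baireDist x y ≤ 1 / ((n : ℝ) + 1) ↔ ∀ k < n, x k = y k := by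
  classical
  unfold baireDist
  split_ifs with h
  · rw [one_div_le_one_div (by positivity) (by positivity)]
    constructor
    · intro h1 k hk
      have h2 : n ≤ Nat.find h := by
        have : (n : ℝ) ≤ (Nat.find h : ℝ) := by linarith
        exact_mod_cast this
      by_contra h3
      exact Nat.find_min h (lt_of_lt_of_le hk h2) h3
    · intro h1
      have h2 : n ≤ Nat.find h := by
        by_contra h3
        exact Nat.find_spec h (h1 _ (not_le.1 h3))
      have : (n : ℝ) ≤ (Nat.find h : ℝ) := by exact_mod_cast h2
      linarith
  · push Not at h
    exact ⟨fun _ k _ => h k, fun _ => by positivity⟩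

theorem eq_of_baireDist_eq_zero {A : Type*} {x y : InfWord A} (h : baireDist x y = 0) :
    x = y := by
  funext k
  have h1 : baireDist x y ≤ 1 / (((k + 1 : ℕ) : ℝ) + 1) := by rw [h]; positivity
  exact (baireDist_le_iff x y (k + 1)).1 h1 k (Nat.lt_succ_self k)

theorem baireDist_le_max {A : Type*} (x y w : InfWord A) :
    baireDist x w ≤ max (baireDist x y) (baireDist y w) := by
  classical
  by_cases h : ∃ n : ℕ, x n ≠ w n
  · have e : baireDist x w = 1 / ((Nat.find h : ℝ) + 1) := by rw [baireDist, dif_pos h]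
    have hs := Nat.find_spec h
    set m := Nat.find h
    have key : ∀ u v : InfWord A, u m ≠ v m → 1 / ((m : ℝ) + 1) ≤ baireDist u v := by
      intro u v huv
      have h' : ∃ n : ℕ, u n ≠ v n := ⟨m, huv⟩
      rw [baireDist, dif_pos h', one_div_le_one_div (by positivity) (by positivity)]
      have : (Nat.find h' : ℝ) ≤ (m : ℝ) := by exact_mod_cast Nat.find_min' h' huv
      linarith
    rw [e]
    by_cases hxy : x m = y m
    · exact le_max_of_le_right (key y w (hxy ▸ hs))
    · exact le_max_of_le_left (key x y hxy)
  · rw [baireDist, dif_neg h]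
    exact le_max_of_le_left (baireDist_nonneg x y)

noncomputable instance instMetricSpace (A : Type*) : MetricSpace (InfWord A) where
  dist := baireDist
  dist_self := baireDist_self
  dist_comm := baireDist_comm
  dist_triangle x y w := (baireDist_le_max x y w).trans
    (max_le_add_of_nonneg (baireDist_nonneg x y) (baireDist_nonneg y w))
  eq_of_dist_eq_zero := eq_of_baireDist_eq_zero

/-- The infinite word `s a b b b …`: the finite word `s`, then `a`, then `b` forever. -/
def word {A : Type*} (s : List A) (a b : A) : InfWord A :=
  fun k => if h : k < s.length then s[k] else if k = s.length then a else b

theorem word_length {A : Type*} (s : List A) (a b : A) : word s a b s.length = a := by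
  simp [word]

theorem word_of_lt {A : Type*} (s : List A) (a b : A) {k : ℕ} (h : k < s.length) :
    word s a b k = s[k] := by
  simp [word, h]

theorem word_of_gt {A : Type*} (s : List A) (a b : A) {k : ℕ} (h : s.length < k) :
    word s a b k = b := by
  simp [word, h.not_gt, h.ne']

end InfWord

namespace LoopGraph

open InfWord

/-- The relation identifying `s a b b b …` with `s b a a a …` whenever `{a, b}` is an edge. -/
def Rel {A : Type*} (G : LoopGraph A) (x y : InfWord A) : Prop :=
  x = y ∨ ∃ (s : List A) (a b : A), s(a, b) ∈ G.edges ∧ x = word s a b ∧ y = word s b a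

theorem rel_equivalence {A : Type*} (G : LoopGraph A) : Equivalence G.Rel where
  refl _ := Or.inl rfl
  symm := by
    rintro x y (h | ⟨s, a, b, he, hx, hy⟩)
    · exact Or.inl h.symm
    · exact Or.inr ⟨s, b, a, by rwa [Sym2.eq_swap], hy, hx⟩
  trans := by
    rintro x y w (rfl | ⟨s, a, b, he, hx, hy⟩) hyw
    · exact hyw
    rcases hyw with rfl | ⟨t, c, d, he', hy', hw⟩
    · exact Or.inr ⟨s, a, b, he, hx, hy⟩
    by_cases hab : a = b
    · subst hab
      rw [← hy] at hx
      subst hx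
      exact Or.inr ⟨t, c, d, he', hy', hw⟩
    by_cases hcd : c = d
    · subst hcd
      rw [← hy'] at hw
      subst hw
      exact Or.inr ⟨s, a, b, he, hx, hy⟩
    have hyy : ∀ k, word s b a k = word t c d k := fun k => by rw [← hy, ← hy']
    rcases lt_trichotomy s.length t.length with hl | hl | hl
    · have h1 := hyy t.length
      have h2 := hyy (t.length + 1)
      rw [word_of_gt _ _ _ hl, word_length] at h1
      rw [word_of_gt _ _ _ (by omega), word_of_gt _ _ _ (by omega)] at h2
      exact absurd (h1.symm.trans h2) hcd
    · have h1 := hyy s.length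
      rw [word_length, hl, word_length] at h1
      have h2 := hyy (t.length + 1)
      rw [word_of_gt _ _ _ (by omega), word_of_gt _ _ _ (by omega)] at h2
      have h3 : s = t := by
        refine List.ext_getElem hl fun k hk hk' => ?_
        have := hyy k
        rwa [word_of_lt _ _ _ hk, word_of_lt _ _ _ hk'] at this
      subst h1 h2 h3
      exact Or.inl (hx.trans hw.symm)
    · have h1 := hyy s.length
      have h2 := hyy (s.length + 1)
      rw [word_length, word_of_gt _ _ _ hl] at h1
      rw [word_of_gt _ _ _ (by omega), word_of_gt _ _ _ (by omega)] at h2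
      exact absurd (h2.trans h1.symm) hab

def relSetoid {A : Type*} (G : LoopGraph A) : Setoid (InfWord A) := ⟨G.Rel, G.rel_equivalence⟩

/-- The graph Lipscomb space: the quotient of the Baire space by the above relation. -/
def LipscombSpace {A : Type*} (G : LoopGraph A) : Type _ := Quotient G.relSetoid

/-- The quotient topology. -/
noncomputable instance instTopologicalSpaceLipscombSpace {A : Type*} (G : LoopGraph A) :
    TopologicalSpace G.LipscombSpace :=
  instTopologicalSpaceQuotient (s := G.relSetoid)

/-- The coefficients `c a a' b`. -/
noncomputable def coeff {A : Type*} (G : LoopGraph A) (a a' b : A) : ℝ :=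
  open Classical in
  if a' = b then (if s(a, a') ∈ G.edges then 1 / 2 else 1 / 3) else 0

/-- The coordinates `α_b(x) = ∑_i ∏_{j ≤ i} c (x j) (x i) b`. -/
noncomputable def coord {A : Type*} (G : LoopGraph A) (x : InfWord A) (b : A) : ℝ :=
  ∑' i : ℕ, ∏ j ∈ Finset.range (i + 1), G.coeff (x j) (x i) b

theorem coeff_nonneg {A : Type*} (G : LoopGraph A) (a a' b : A) : 0 ≤ G.coeff a a' b := by
  unfold coeff
  split_ifs <;> norm_num

theorem coeff_le {A : Type*} (G : LoopGraph A) (a a' b : A) : G.coeff a a' b ≤ 1 / 2 := by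
  unfold coeff
  split_ifs <;> norm_num

theorem term_nonneg {A : Type*} (G : LoopGraph A) (x : InfWord A) (b : A) (i : ℕ) :
    0 ≤ ∏ j ∈ Finset.range (i + 1), G.coeff (x j) (x i) b :=
  Finset.prod_nonneg fun _ _ => G.coeff_nonneg _ _ _

theorem term_le {A : Type*} (G : LoopGraph A) (x : InfWord A) (b : A) (i : ℕ) :
    ∏ j ∈ Finset.range (i + 1), G.coeff (x j) (x i) b ≤ (1 / 2 : ℝ) ^ (i + 1) := by
  calc _ ≤ ∏ _j ∈ Finset.range (i + 1), (1 / 2 : ℝ) :=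
        Finset.prod_le_prod (fun _ _ => G.coeff_nonneg _ _ _) (fun _ _ => G.coeff_le _ _ _)
    _ = _ := by simp

theorem term_eq_zero {A : Type*} (G : LoopGraph A) (x : InfWord A) (b : A) (i : ℕ)
    (h : x i ≠ b) : ∏ j ∈ Finset.range (i + 1), G.coeff (x j) (x i) b = 0 :=
  Finset.prod_eq_zero (Finset.self_mem_range_succ i) (by simp [coeff, h])

theorem summable_half : Summable fun i : ℕ => (1 / 2 : ℝ) ^ (i + 1) :=
  (summable_nat_add_iff 1).2 (summable_geometric_of_lt_one (by norm_num) (by norm_num))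

/-- The series defining a coordinate converges. -/
theorem summable_term {A : Type*} (G : LoopGraph A) (x : InfWord A) (b : A) :
    Summable fun i : ℕ => ∏ j ∈ Finset.range (i + 1), G.coeff (x j) (x i) b :=
  Summable.of_nonneg_of_le (G.term_nonneg x b) (G.term_le x b) summable_half

theorem sum_coord_le {A : Type*} (G : LoopGraph A) (x : InfWord A) (z : A)
    (u : Finset {a : A // a ≠ z}) :
    ∑ b ∈ u, G.coord x b ≤ ∑' i : ℕ, (1 / 2 : ℝ) ^ (i + 1) := by
  classical
  unfold coord
  rw [← Summable.tsum_finsetSum fun (b : {a : A // a ≠ z}) _ => G.summable_term x b]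
  refine Summable.tsum_le_tsum (fun i => ?_) (summable_sum fun b _ => G.summable_term x b)
    summable_half
  by_cases h : ∃ b ∈ u, x i = (b : A)
  · obtain ⟨b, hb, hxb⟩ := h
    rw [Finset.sum_eq_single b]
    · exact G.term_le x b i
    · intro b' _ hne
      exact G.term_eq_zero x b' i fun h => hne (Subtype.ext (h.symm.trans hxb))
    · exact fun h => absurd hb h
  · push Not at h
    rw [Finset.sum_eq_zero fun (b : {a : A // a ≠ z}) hb => G.term_eq_zero x b i (h b hb)]
    positivity

theorem memℓp_coord {A : Type*} (G : LoopGraph A) (z : A) (x : InfWord A) :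
    Memℓp (fun b : {a : A // a ≠ z} => G.coord x b) 2 := by
  have h0 : ∀ b, 0 ≤ G.coord x b := fun b => tsum_nonneg (G.term_nonneg x b)
  have h1 : Memℓp (fun b : {a : A // a ≠ z} => G.coord x b) 1 := by
    refine memℓp_gen ?_
    simp only [ENNReal.toReal_one, Real.rpow_one, Real.norm_eq_abs, abs_of_nonneg (h0 _)]
    exact summable_of_sum_le (fun b => h0 b) (G.sum_coord_le x z)
  exact h1.of_exponent_ge (by norm_num)

/-- The map `x ↦ (α_b(x))_b` from the Baire space to the real Hilbert space `ℓ²(A ∖ {z})`. -/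
noncomputable def toEllTwo {A : Type*} (G : LoopGraph A) (z : A) (x : InfWord A) :
    lp (fun _ : {a : A // a ≠ z} => ℝ) 2 :=
  ⟨fun b => G.coord x b, G.memℓp_coord z x⟩

/-- The embedded version of the graph Lipscomb space in `ℓ²(A ∖ {z})`. -/
def omega {A : Type*} (G : LoopGraph A) (z : A) : Set (lp (fun _ : {a : A // a ≠ z} => ℝ) 2) :=
  Set.range (G.toEllTwo z)

end LoopGraph

/-! The proof goes round the cycle (iii) → (i) → (ii) → (iii). If the graph is connected, a clopen
splitting of the quotient pulls back to a splitting of the word space into saturated open sets. The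
identifications glue adjacent subcylinders of a cylinder, so if the cylinder meets both sides, so
does one of its subcylinders (`exists_letter_of_meets`). Iterating yields a word all of whose
neighbourhoods meet both sides, which is absurd. The map to ℓ² is continuous and constant on
classes, so `omega` is a continuous image of the quotient. If the graph is disconnected, the values
1/2 and 1/3 of the coefficients leave a gap between words starting in a union of components and
words starting outside it (`not_isPreconnected_omega`). -/

namespace InfWord

/-! ### Cylinders in the word space -/

variable {A : Type*}

theorem dist_le_iff (x y : InfWord A) (n : ℕ) :
    dist x y ≤ 1 / ((n : ℝ) + 1) ↔ ∀ k < n, x k = y k :=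
  baireDist_le_iff x y n

/-- An open set contains a cylinder around each of its points. -/
theorem exists_cylinder_subset {U : Set (InfWord A)} (hU : IsOpen U) {x : InfWord A}
    (hx : x ∈ U) : ∃ n : ℕ, ∀ y : InfWord A, (∀ k < n, y k = x k) → y ∈ U := by
  obtain ⟨ε, hε, hb⟩ := Metric.isOpen_iff.1 hU x hx
  obtain ⟨n, hn⟩ := exists_nat_one_div_lt hε
  exact ⟨n, fun y hy => hb (lt_of_le_of_lt ((dist_le_iff y x n).2 hy) hn)⟩

/-- A function depending on finitely many letters only is continuous. -/
theorem continuous_of_depends_on_prefix {X : Type*} [TopologicalSpace X] (f : InfWord A → X)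
    (n : ℕ) (hf : ∀ x y : InfWord A, (∀ k < n, x k = y k) → f x = f y) : Continuous f := by
  refine IsLocallyConstant.continuous ((IsLocallyConstant.iff_eventually_eq f).2 fun x => ?_)
  filter_upwards [Metric.ball_mem_nhds x (show (0 : ℝ) < 1 / ((n : ℝ) + 1) by positivity)]
    with y hy
  exact hf y x ((dist_le_iff y x n).1 (Metric.mem_ball.1 hy).le)

end InfWord

namespace LoopGraph

open InfWord

variable {A : Type*} (G : LoopGraph A)

/-! ### Connected graph implies connected quotient -/

/-- A graph is connected once every nonempty set of vertices closed under adjacency is everything. -/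
theorem connected_of_forall_closed
    (h : ∀ C : Set A, C.Nonempty → (∀ a ∈ C, ∀ b, s(a, b) ∈ G.edges → b ∈ C) → C = Set.univ) :
    G.Connected := by
  intro v u
  have key := h {u | ∃ (n : ℕ) (w : ℕ → A), w 0 = v ∧ w n = u ∧
    ∀ k < n, s(w k, w (k + 1)) ∈ G.edges} ⟨v, 0, fun _ => v, rfl, rfl, by simp⟩ ?_
  · exact key.symm.subset (Set.mem_univ u)
  · rintro a ⟨n, w, h0, hn, hw⟩ b hab
    refine ⟨n + 1, fun k => if k ≤ n then w k else b, by simpa using h0, by simp, fun k hk => ?_⟩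
    rcases Nat.lt_succ_iff_lt_or_eq.1 hk with hk | rfl
    · have h1 : k + 1 ≤ n := hk
      simpa [hk.le, h1] using hw k hk
    · simpa [hn] using hab

theorem Connected.of_forall_adj {G : LoopGraph A} (hG : G.Connected) {P : A → Prop}
    (hP : ∀ a b, s(a, b) ∈ G.edges → P a → P b) {v : A} (hv : P v) (u : A) : P u := by
  obtain ⟨n, w, h0, hn, hw⟩ := hG v u
  have : ∀ k ≤ n, P (w k) := by
    intro k
    induction k with
    | zero => exact fun _ => h0 ▸ hv
    | succ k ih => exact fun hk => hP _ _ (hw k hk) (ih (by omega))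
  exact hn ▸ this n le_rfl

/-- If the cylinder of `s` meets two disjoint saturated sets covering everything, then so does the
cylinder of `s` followed by some letter. -/
theorem exists_letter_of_meets {G : LoopGraph A} (hG : G.Connected) {U V : Set (InfWord A)}
    (hUV : ∀ x, x ∈ U ∨ x ∈ V) (hsU : ∀ x y, G.Rel x y → x ∈ U → y ∈ U) (s : List A)
    (hd : Disjoint U V)
    (hu : ∃ x ∈ U, ∀ (k : ℕ) (h : k < s.length), x k = s[k])
    (hv : ∃ x ∈ V, ∀ (k : ℕ) (h : k < s.length), x k = s[k]) :
    ∃ a : A, (∃ x ∈ U, (∀ (k : ℕ) (h : k < s.length), x k = s[k]) ∧ x s.length = a) ∧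
      ∃ x ∈ V, (∀ (k : ℕ) (h : k < s.length), x k = s[k]) ∧ x s.length = a := by
  by_contra! hcon
  obtain ⟨x, hxU, hx⟩ := hu
  obtain ⟨y, hyV, hy⟩ := hv
  -- Without such a letter each subcylinder lies wholly in `U` or wholly in `V`. Lying in `U` passes
  -- along an edge `{a, b}`, since `word s a b` and `word s b a` are identified.
  have hall := hG.of_forall_adj
    (P := fun a => ∀ x : InfWord A, (∀ (k : ℕ) (h : k < s.length), x k = s[k]) →
      x s.length = a → x ∈ U) ?_ (v := x s.length) ?_ (y s.length) y hy rfl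
  · exact Set.disjoint_left.1 hd hall hyV
  · intro a b hab ha x hx hxb
    have h1 : word s a b ∈ U := ha _ (fun k h => word_of_lt s a b h) (word_length s a b)
    have h2 : word s b a ∈ U := hsU _ _ (Or.inr ⟨s, a, b, hab, rfl, rfl⟩) h1
    exact (hUV x).resolve_right fun hxV =>
      hcon b ⟨_, h2, fun k h => word_of_lt s b a h, word_length s b a⟩ x hxV hx hxb
  · intro x' hx' hxx
    exact (hUV x').resolve_right fun hxV => hcon _ ⟨x, hxU, hx, rfl⟩ x' hxV hx' hxx

/-- A nested-cylinder argument: extending the empty prefix one letter at a time, always meeting both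
sides, builds an infinite word that can lie in neither open set. -/
theorem false_of_separation {G : LoopGraph A} (hG : G.Connected) {U V : Set (InfWord A)}
    (hU : IsOpen U) (hV : IsOpen V) (hUV : ∀ x, x ∈ U ∨ x ∈ V)
    (hsU : ∀ x y, G.Rel x y → x ∈ U → y ∈ U) (hd : Disjoint U V) (hUn : U.Nonempty)
    (hVn : V.Nonempty) : False := by
  let M : List A → Prop := fun s => (∃ x ∈ U, ∀ (k : ℕ) (h : k < s.length), x k = s[k]) ∧
    ∃ x ∈ V, ∀ (k : ℕ) (h : k < s.length), x k = s[k]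
  have hstep : ∀ s : List A, M s → ∃ a, M (s ++ [a]) := by
    intro s hs
    obtain ⟨a, ⟨x, hxU, hx, hxa⟩, ⟨y, hyV, hy, hya⟩⟩ :=
      exists_letter_of_meets hG hUV hsU s hd hs.1 hs.2
    have key : ∀ x : InfWord A, (∀ (k : ℕ) (h : k < s.length), x k = s[k]) → x s.length = a →
        ∀ (k : ℕ) (h : k < (s ++ [a]).length), x k = (s ++ [a])[k] := by
      intro x hx hxa k hk
      by_cases h : k < s.length
      · rw [List.getElem_append_left h, hx k h]
      · have hk' : k = s.length := by simp at hk; omega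
        subst hk'
        simp [hxa]
    exact ⟨a, ⟨x, hxU, key x hx hxa⟩, ⟨y, hyV, key y hy hya⟩⟩
  have h0 : M [] := ⟨⟨_, hUn.some_mem, by simp⟩, ⟨_, hVn.some_mem, by simp⟩⟩
  choose a ha using hstep
  let S : ℕ → {s : List A // M s} := fun n =>
    Nat.rec ⟨[], h0⟩ (fun _ s => ⟨s.1 ++ [a s.1 s.2], ha s.1 s.2⟩) n
  have hS : ∀ n, (S (n + 1)).1 = (S n).1 ++ [a (S n).1 (S n).2] := fun n => rfl
  have hlen : ∀ n, (S n).1.length = n := by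
    intro n
    induction n with
    | zero => rfl
    | succ n ih => rw [hS]; simp [ih]
  let w : InfWord A := fun n => a (S n).1 (S n).2
  have hw : ∀ n (k : ℕ) (h : k < (S n).1.length), (S n).1[k] = w k := by
    intro n
    induction n with
    | zero => intro k h; rw [hlen] at h; omega
    | succ n ih =>
      intro k h
      have hk : k < n + 1 := by simpa [hlen] using h
      simp only [hS]
      by_cases hkn : k < n
      · rw [List.getElem_append_left (by rwa [hlen])]
        exact ih k _
      · have : k = n := by omega
        subst this
        rw [List.getElem_append_right (by rw [hlen])]
        simp [w]
  rcases hUV w with h | h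
  · obtain ⟨n, hn⟩ := exists_cylinder_subset hU h
    obtain ⟨y, hyV, hy⟩ := (S n).2.2
    exact Set.disjoint_left.1 hd (hn y fun k hk => (hy k (by rwa [hlen])).trans (hw n k _)) hyV
  · obtain ⟨n, hn⟩ := exists_cylinder_subset hV h
    obtain ⟨y, hyU, hy⟩ := (S n).2.1
    exact Set.disjoint_left.1 hd hyU (hn y fun k hk => (hy k (by rwa [hlen])).trans (hw n k _))

theorem Connected.connectedSpace_lipscombSpace [Nonempty A] {G : LoopGraph A} (hG : G.Connected) :
    ConnectedSpace G.LipscombSpace := by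
  let π : InfWord A → G.LipscombSpace := Quotient.mk G.relSetoid
  have hπ : Continuous π := continuous_quot_mk
  have hsurj : Function.Surjective π := Quotient.mk_surjective
  have hne : Nonempty G.LipscombSpace := ⟨π fun _ => Classical.arbitrary A⟩
  have : PreconnectedSpace G.LipscombSpace := by
    refine preconnectedSpace_iff_clopen.2 fun W hW => ?_
    by_contra! hcon
    obtain ⟨p, hp⟩ := hcon.1
    obtain ⟨q, hq⟩ := (Set.ne_univ_iff_exists_notMem W).1 hcon.2
    obtain ⟨x, rfl⟩ := hsurj p
    obtain ⟨y, rfl⟩ := hsurj q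
    refine false_of_separation hG (U := π ⁻¹' W) (V := π ⁻¹' Wᶜ) (hW.isOpen.preimage hπ)
      (hW.compl.isOpen.preimage hπ) (fun x => Classical.em _) (fun x y hxy hx => ?_)
      (disjoint_compl_right.preimage π) ⟨x, hp⟩ ⟨y, hq⟩
    have : π x = π y := Quotient.sound (s := G.relSetoid) hxy
    rwa [Set.mem_preimage, ← this]
  exact ⟨hne⟩

/-! ### Coordinates are constant on classes -/

theorem coeff_self (b : A) : G.coeff b b b = 1 / 2 := by
  simp [coeff, G.loop_mem]

theorem coeff_of_mem {a b : A} (h : s(a, b) ∈ G.edges) : G.coeff a b b = 1 / 2 := by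
  simp [coeff, h]

theorem coeff_of_notMem {a b : A} (h : s(a, b) ∉ G.edges) : G.coeff a b b = 1 / 3 := by
  simp [coeff, h]

/-- The `i`-th term of the series defining a coordinate depends on the first `i + 1` letters. -/
theorem term_congr {x y : InfWord A} (b : A) {i : ℕ} (h : ∀ k < i + 1, x k = y k) :
    ∏ j ∈ Finset.range (i + 1), G.coeff (x j) (x i) b =
      ∏ j ∈ Finset.range (i + 1), G.coeff (y j) (y i) b :=
  Finset.prod_congr rfl fun j hj => by
    rw [h j (Finset.mem_range.1 hj), h i (Nat.lt_succ_self i)]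

theorem prod_word_prefix (s : List A) (a b c : A) :
    ∏ j ∈ Finset.range s.length, G.coeff (word s a b j) c c =
      ∏ j : Fin s.length, G.coeff s[j] c c := by
  rw [Finset.prod_range]
  exact Finset.prod_congr rfl fun j _ => by rw [word_of_lt s a b j.2]; rfl

/-- The value is symmetric in `a` and `b`: the single letter `a` contributes its weight in one term,
while the repeated `b` contributes the same weight times 1/2 + 1/4 + ⋯ = 1. -/
theorem tail_word (s : List A) {a b : A} (hab : s(a, b) ∈ G.edges) (hne : a ≠ b) (c : A) :
    HasSum (fun i : ℕ => ∏ j ∈ Finset.range (i + s.length + 1),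
      G.coeff (word s a b j) (word s a b (i + s.length)) c)
      (open Classical in if c = a ∨ c = b then
        (∏ j : Fin s.length, G.coeff s[j] c c) * (1 / 2) else 0) := by
  rcases eq_or_ne c a with rfl | hca
  · have h0 : ∀ i ≠ 0, ∏ j ∈ Finset.range (i + s.length + 1),
        G.coeff (word s c b j) (word s c b (i + s.length)) c = 0 := fun i hi =>
      G.term_eq_zero _ _ _ (by rw [word_of_gt _ _ _ (by omega)]; exact hne.symm)
    convert hasSum_single 0 h0 using 1
    simp only [zero_add, true_or, if_true, word_length]
    rw [Finset.prod_range_succ, word_length, coeff_self, prod_word_prefix]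
  rcases eq_or_ne c b with rfl | hcb
  · rw [← hasSum_nat_add_iff' 1]
    have h0 : ∏ j ∈ Finset.range (0 + s.length + 1),
        G.coeff (word s a c j) (word s a c (0 + s.length)) c = 0 :=
      G.term_eq_zero _ _ _ (by rw [zero_add, word_length]; exact hne)
    have h1 : ∀ i : ℕ, ∏ j ∈ Finset.range (i + 1 + s.length + 1),
        G.coeff (word s a c j) (word s a c (i + 1 + s.length)) c =
        (∏ j : Fin s.length, G.coeff s[j] c c) * (1 / 2) * ((1 / 2) ^ (i + 1)) := by
      intro i
      rw [word_of_gt _ _ _ (by omega),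
        show i + 1 + s.length + 1 = s.length + 1 + (i + 1) by omega, Finset.prod_range_add,
        Finset.prod_range_succ, prod_word_prefix, word_length, G.coeff_of_mem hab]
      congr 1
      rw [Finset.prod_congr rfl fun j _ => by rw [word_of_gt _ _ _ (by omega), coeff_self]]
      simp
    simp only [h1, Finset.sum_range_one, h0, sub_zero, or_true, if_true]
    have h2 : HasSum (fun i : ℕ => (1 / 2 : ℝ) ^ (i + 1)) 1 := by
      simpa [pow_succ, div_eq_mul_inv] using hasSum_geometric_two.mul_right (1 / 2 : ℝ)
    simpa using h2.mul_left ((∏ j : Fin s.length, G.coeff s[j] c c) * (1 / 2))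
  · have h0 : ∀ i : ℕ, ∏ j ∈ Finset.range (i + s.length + 1),
        G.coeff (word s a b j) (word s a b (i + s.length)) c = 0 := by
      intro i
      refine G.term_eq_zero _ _ _ ?_
      rcases Nat.eq_zero_or_pos i with rfl | hi
      · rw [zero_add, word_length]; exact hca.symm
      · rw [word_of_gt _ _ _ (by omega)]; exact hcb.symm
    simp only [h0, hca, hcb, or_self, if_false]
    exact hasSum_zero

/-- Identified words have the same coordinates. -/
theorem coord_eq_of_rel {x y : InfWord A} (h : G.Rel x y) (c : A) :
    G.coord x c = G.coord y c := by
  classical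
  rcases h with rfl | ⟨s, a, b, hab, rfl, rfl⟩
  · rfl
  rcases eq_or_ne a b with rfl | hne
  · rfl
  have hba : s(b, a) ∈ G.edges := by rwa [Sym2.eq_swap]
  unfold coord
  rw [← (G.summable_term (word s a b) c).sum_add_tsum_nat_add s.length,
    ← (G.summable_term (word s b a) c).sum_add_tsum_nat_add s.length,
    (G.tail_word s hab hne c).tsum_eq, (G.tail_word s hba hne.symm c).tsum_eq]
  congr 1
  · refine Finset.sum_congr rfl fun i hi => G.term_congr c fun k hk => ?_
    have hks : k < s.length := by have := Finset.mem_range.1 hi; omega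
    rw [word_of_lt _ _ _ hks, word_of_lt _ _ _ hks]
  · simp only [or_comm]

/-! ### Continuity of the map into ℓ² -/

open Classical in
/-- The contribution of the `i`-th letter of a word to its image in `ℓ²(A ∖ {z})`. -/
noncomputable def letterTerm (z : A) (i : ℕ) (x : InfWord A) :
    lp (fun _ : {a : A // a ≠ z} => ℝ) 2 :=
  if h : x i ≠ z then
    lp.single 2 (⟨x i, h⟩ : {a : A // a ≠ z})
      (∏ j ∈ Finset.range (i + 1), G.coeff (x j) (x i) (x i))
  else 0

theorem norm_letterTerm_le (z : A) (i : ℕ) (x : InfWord A) :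
    ‖G.letterTerm z i x‖ ≤ (1 / 2 : ℝ) ^ (i + 1) := by
  classical
  unfold letterTerm
  split_ifs with h
  · rw [lp.norm_single (by norm_num), Real.norm_eq_abs, abs_of_nonneg (G.term_nonneg _ _ _)]
    exact G.term_le x _ i
  · rw [norm_zero]; positivity

theorem letterTerm_apply (z : A) (i : ℕ) (x : InfWord A) (b : {a : A // a ≠ z}) :
    G.letterTerm z i x b = ∏ j ∈ Finset.range (i + 1), G.coeff (x j) (x i) b := by
  classical
  unfold letterTerm
  split_ifs with h
  · by_cases hb : x i = b
    · have : b = ⟨x i, h⟩ := Subtype.ext hb.symm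
      subst this
      simp
    · rw [G.term_eq_zero x b i hb, lp.single_apply_ne]
      exact fun h' => hb (congrArg Subtype.val h').symm
  · rw [G.term_eq_zero x b i fun hb => h (hb ▸ b.2)]
    rfl

theorem toEllTwo_eq_tsum (z : A) (x : InfWord A) :
    G.toEllTwo z x = ∑' i, G.letterTerm z i x := by
  have hs : Summable fun i => G.letterTerm z i x :=
    Summable.of_norm_bounded summable_half fun i => G.norm_letterTerm_le z i x
  ext b
  have h1 := hs.hasSum.mapL (lp.evalCLM ℝ (fun _ : {a : A // a ≠ z} => ℝ) 2 b)
  have h2 : HasSum (fun i => ∏ j ∈ Finset.range (i + 1), G.coeff (x j) (x i) b)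
      ((∑' i, G.letterTerm z i x : lp (fun _ : {a : A // a ≠ z} => ℝ) 2) b) :=
    by
    simp only [← letterTerm_apply]
    exact h1
  exact h2.tsum_eq

/-- Each letter's contribution is locally constant, and the series of contributions converges
uniformly by the geometric bound. -/
theorem continuous_toEllTwo (z : A) : Continuous (G.toEllTwo z) := by
  have : G.toEllTwo z = fun x => ∑' i, G.letterTerm z i x := funext (G.toEllTwo_eq_tsum z)
  rw [this]
  refine continuous_tsum (fun i => ?_) summable_half fun i x => G.norm_letterTerm_le z i x
  refine continuous_of_depends_on_prefix _ (i + 1) fun x y h => ?_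
  ext b
  rw [letterTerm_apply, letterTerm_apply, G.term_congr _ h]

theorem isConnected_omega_of_connectedSpace (z : A) [ConnectedSpace G.LipscombSpace] :
    IsConnected (G.omega z) := by
  let f : G.LipscombSpace → lp (fun _ : {a : A // a ≠ z} => ℝ) 2 :=
    Quotient.lift (s := G.relSetoid) (G.toEllTwo z) fun x y h =>
      lp.ext (funext fun b => G.coord_eq_of_rel h b)
  have hf : Continuous f := (G.continuous_toEllTwo z).quotient_lift _
  have hr : Set.range f = G.omega z :=
    Set.range_quotient_lift (s := G.relSetoid) _
  exact hr ▸ isConnected_range hf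

/-! ### Disconnected graph implies disconnected image -/

theorem half_le_coord (x : InfWord A) : 1 / 2 ≤ G.coord x (x 0) := by
  have h := (G.summable_term x (x 0)).le_tsum 0 fun i _ => G.term_nonneg x (x 0) i
  simpa [coord, G.coeff_self] using h

theorem term_succ_le_of_notMem (x : InfWord A) {b : A} (h : s(x 0, b) ∉ G.edges) (i : ℕ) :
    ∏ j ∈ Finset.range (i + 1 + 1), G.coeff (x j) (x (i + 1)) b ≤
      1 / 3 * (1 / 2 : ℝ) ^ (i + 1) := by
  by_cases hb : x (i + 1) = b
  -- The factor `j = 0` is 1/3 because `x 0` is not adjacent to `b`; the other factors are at most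
  -- 1/2.
  · rw [Finset.prod_range_succ', mul_comm, hb, G.coeff_of_notMem h]
    refine mul_le_mul_of_nonneg_left ?_ (by norm_num)
    simpa using Finset.prod_le_prod (s := Finset.range (i + 1))
      (fun j _ => G.coeff_nonneg (x (j + 1)) b b) (fun j _ => G.coeff_le (x (j + 1)) b b)
  · rw [G.term_eq_zero x b _ hb]
    positivity

theorem coord_le_third (x : InfWord A) {b : A} (h : s(x 0, b) ∉ G.edges) :
    G.coord x b ≤ 1 / 3 := by
  have hne : x 0 ≠ b := by
    rintro rfl
    exact h (G.loop_mem _)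
  have h2 : HasSum (fun i : ℕ => 1 / 3 * (1 / 2 : ℝ) ^ (i + 1)) (1 / 3) := by
    simpa [pow_succ, div_eq_mul_inv] using
      (hasSum_geometric_two.mul_right (1 / 2 : ℝ)).mul_left (1 / 3 : ℝ)
  have h3 := (summable_nat_add_iff 1).2 (G.summable_term x b)
  rw [coord, (G.summable_term x b).tsum_eq_zero_add, G.term_eq_zero x b 0 hne, zero_add]
  exact hasSum_le (G.term_succ_le_of_notMem x h) h3.hasSum h2

/-- A set of vertices avoiding `z`, without edges to its complement, splits `ω` into two parts at
positive distance. -/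
theorem not_isPreconnected_omega {z : A} {C : Set A} (hz : z ∉ C) (hC : C.Nonempty)
    (hcl : ∀ a ∉ C, ∀ b ∈ C, s(a, b) ∉ G.edges) : ¬ IsPreconnected (G.omega z) := by
  intro hpre
  let U : Set (lp (fun _ : {a : A // a ≠ z} => ℝ) 2) :=
    ⋃ b : {b : {a : A // a ≠ z} // (b : A) ∈ C}, {y | 5 / 12 < y b.1}
  -- The threshold 5/12 is midway between 1/3 and 1/2; radius 1/12 keeps the coordinates indexed by
  -- `C` below it on these balls.
  let V : Set (lp (fun _ : {a : A // a ≠ z} => ℝ) 2) :=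
    ⋃ x : {x : InfWord A // x 0 ∉ C}, Metric.ball (G.toEllTwo z x.1) (1 / 12)
  have hU : IsOpen U := isOpen_iUnion fun b => isOpen_lt continuous_const
    (lp.evalCLM ℝ (fun _ : {a : A // a ≠ z} => ℝ) 2 b.1).continuous
  have hV : IsOpen V := isOpen_iUnion fun _ => Metric.isOpen_ball
  have hxU : ∀ x : InfWord A, x 0 ∈ C → G.toEllTwo z x ∈ U := fun x hx => by
    refine Set.mem_iUnion.2 ⟨⟨⟨x 0, fun h => hz (h ▸ hx)⟩, hx⟩, ?_⟩
    exact lt_of_lt_of_le (by norm_num) (G.half_le_coord x)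
  have hxV : ∀ x : InfWord A, x 0 ∉ C → G.toEllTwo z x ∈ V := fun x hx =>
    Set.mem_iUnion.2 ⟨⟨x, hx⟩, Metric.mem_ball_self (by norm_num)⟩
  obtain ⟨c, hc⟩ := hC
  obtain ⟨y, -, hyU, hyV⟩ := hpre U V hU hV
    (by rintro _ ⟨x, rfl⟩; exact (Classical.em (x 0 ∈ C)).imp (hxU x) (hxV x))
    ⟨_, ⟨fun _ => c, rfl⟩, hxU _ hc⟩ ⟨_, ⟨fun _ => z, rfl⟩, hxV _ hz⟩
  obtain ⟨⟨b, hb⟩, hyb⟩ := Set.mem_iUnion.1 hyU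
  obtain ⟨⟨x, hx⟩, hyx⟩ := Set.mem_iUnion.1 hyV
  have h1 : G.toEllTwo z x b ≤ 1 / 3 := G.coord_le_third x (hcl _ hx _ hb)
  have h2 : ‖(y - G.toEllTwo z x) b‖ ≤ ‖y - G.toEllTwo z x‖ :=
    lp.norm_apply_le_norm (by norm_num) _ b
  have h3 : ‖y - G.toEllTwo z x‖ < 1 / 12 := by rw [← dist_eq_norm]; exact hyx
  have h4 : y b - G.toEllTwo z x b ≤ ‖(y - G.toEllTwo z x) b‖ := le_abs_self _
  have h5 : 5 / 12 < y b := hyb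
  linarith

theorem connected_of_isConnected_omega {z : A} (h : IsConnected (G.omega z)) : G.Connected := by
  refine G.connected_of_forall_closed fun C hC hcl => ?_
  by_contra hne
  -- There is no coordinate at `z`, so whichever of `C` and its complement avoids `z` is used.
  by_cases hz : z ∈ C
  · refine G.not_isPreconnected_omega (C := Cᶜ) (not_not_intro hz)
      (Set.nonempty_compl.2 hne) (fun a ha b hb hab => hb (hcl a (not_not.1 ha) b hab))
      h.isPreconnected
  · refine G.not_isPreconnected_omega hz hC (fun a ha b hb hab => ha (hcl b hb a ?_))
      h.isPreconnected
    rwa [Sym2.eq_swap]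

end LoopGraph

theorem mainTheorem1 {A : Type*} [Nontrivial A] (G : LoopGraph A) (z : A) :
    List.TFAE [ConnectedSpace G.LipscombSpace, IsConnected (G.omega z), G.Connected] := by
  tfae_have 1 → 2 := fun _ => G.isConnected_omega_of_connectedSpace z
  tfae_have 2 → 3 := G.connected_of_isConnected_omega
  tfae_have 3 → 1 := fun h => h.connectedSpace_lipscombSpace
  tfae_finish
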